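/- Let $x_1,\dots,x_n\in\mathbb R^d$ and $y_1,\dots,y_n\in\mathbb R$ be arbitrary, let $\ell(\hat y,y)$ be a real-valued loss on $\mathbb R\times\mathbb R$ that, for every fixed $y$, is convex and $C^2$ in $\hat y\in\mathbb R$, and let $\lambda,\delta\in\mathbb R$. For $W\in\mathbb R^{k\times d}$ with rows $w_1,\dots,w_k$ put \[ f(x,W)=\sum_{j=1}^k (w_j^\top x)^2,\qquad L(W)=\frac1{2n}\sum_{i=1}^n \ell\bigl(f(x_i,W),y_i\bigr)+\frac{\lambda}{2}\|W\|_F^2 . \] Suppose $\frac{k(k+1)}2>n$ and $k<d$, and let $C$ be a random symmetric positive semidefinite $d\times d$ matrix with $\|C\|_F\le\delta$ whose law is absolutely continuous with respect to Lebesgue measure on the $\frac{d(d+1)}{2}$-dimensional space of symmetric $d\times d$ matrices. Let $L_C(W)=L(W)+\langle C,W^\top W\rangle$, where $\langle A,B\rangle=\operatorname{tr}(A^\top B)$. Then, with probability $1$: (1) every local minimum of $L_C$ on $\mathbb R^{k\times d}$ is a global minimum; (2) every saddle of $L_C$ is strict: whenever $\nabla L_C(W)=0$ and every neighbourhood of $W$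 contains a point $V$ with $L_C(V)<L_C(W)$, there is $U\in\mathbb R^{k\times d}$ with $\nabla^2L_C(W)[U,U]<0$. Further, for every value of $C$, if $\widehat W$ is a global minimizer of $L_C$ and $W^*$ is a global minimizer of $L$, then \[ L(\widehat W)\le L(W^*)+\delta\|W^*\|_F^2 . \] -/

import Mathlib

open MeasureTheory
open scoped Matrix

attribute [local instance] Matrix.frobeniusNormedAddCommGroup Matrix.frobeniusNormedSpace

noncomputable section

namespace QuadraticNet

/-- The quadratic activation function `σ(z) = z²`. -/
def act (z : ℝ) : ℝ := z ^ 2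

/-- The two-layer network `f(x, W) = ∑ⱼ σ(wⱼᵀ x)`, where `wⱼ` is the `j`-th row of `W`. -/
def net {k d : ℕ} (W : Matrix (Fin k) (Fin d) ℝ) (x : Fin d → ℝ) : ℝ :=
  ∑ j, act (W j ⬝ᵥ x)

/-- The Frobenius inner product `⟨A, B⟩ = tr(Aᵀ B)` of two square matrices. -/
def frobInner {d : ℕ} (A B : Matrix (Fin d) (Fin d) ℝ) : ℝ := (Aᵀ * B).trace

/-- The regularized training loss
`L(W) = (1 / 2n) ∑ᵢ ℓ(f(xᵢ, W), yᵢ) + (lam / 2) ‖W‖_F²`; the norm is the Frobenius norm. -/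
def trainingLoss {n k d : ℕ} (ℓ : ℝ → ℝ → ℝ) (lam : ℝ) (x : Fin n → Fin d → ℝ) (y : Fin n → ℝ)
    (W : Matrix (Fin k) (Fin d) ℝ) : ℝ :=
  1 / (2 * (n : ℝ)) * ∑ i, ℓ (net W (x i)) (y i) + lam / 2 * ‖W‖ ^ 2

/-- The perturbed training loss `L_C(W) = L(W) + ⟨C, Wᵀ W⟩`. -/
def perturbedLoss {n k d : ℕ} (ℓ : ℝ → ℝ → ℝ) (lam : ℝ) (x : Fin n → Fin d → ℝ) (y : Fin n → ℝ)
    (C : Matrix (Fin d) (Fin d) ℝ) (W : Matrix (Fin k) (Fin d) ℝ) : ℝ :=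
  trainingLoss ℓ lam x y W + frobInner C (Wᵀ * W)

/-- `W` is a global minimizer of `L`. -/
def IsGlobalMin {E : Type*} (L : E → ℝ) (W : E) : Prop :=
  ∀ V, L W ≤ L V

/-- All local minima of `L` are global. -/
def LocalMinimaGlobal {E : Type*} [NormedAddCommGroup E] (L : E → ℝ) : Prop :=
  ∀ W, IsLocalMin L W → IsGlobalMin L W

/-- `W` is a saddle point of `L`: a critical point that is not a local minimum, i.e. every
neighbourhood of `W` contains a point with a strictly smaller value of `L`.  Local maxima that
are not local minima are included. -/
def IsSaddle {E : Type*} [NormedAddCommGroup E] [NormedSpace ℝ E] (L : E → ℝ) (W : E) : Prop :=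
  fderiv ℝ L W = 0 ∧ ∀ O ∈ nhds W, ∃ V ∈ O, L V < L W

/-- All saddles of `L` are strict: at each of them the Hessian quadratic form is negative
in some direction `U`. -/
def SaddlesStrict {E : Type*} [NormedAddCommGroup E] [NormedSpace ℝ E] (L : E → ℝ) : Prop :=
  ∀ W, IsSaddle L W → ∃ U : E, fderiv ℝ (fderiv ℝ L) W U U < 0

/-- The entries of a `d × d` matrix on and above the diagonal.  On symmetric matrices these are
linear coordinates, identifying the space of symmetric matrices with `ℝ^(d(d+1)/2)`. -/
def upperEntries {d : ℕ} (C : Matrix (Fin d) (Fin d) ℝ) : {p : Fin d × Fin d // p.1 ≤ p.2} → ℝ :=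
  fun p => C p.1.1 p.1.2

/-- The law of the random symmetric matrix `C` is absolutely continuous with respect to Lebesgue
measure on the space of symmetric `d × d` matrices. -/
def HasAbsContLaw {Ω : Type*} [MeasurableSpace Ω] (μ : Measure Ω) {d : ℕ}
    (C : Ω → Matrix (Fin d) (Fin d) ℝ) : Prop :=
  (∀ i j, Measurable fun ω => C ω i j) ∧ μ.map (fun ω => upperEntries (C ω)) ≪ volume

end QuadraticNet

end

/-! The gradient of `L_C` at `W` is `2 W G`, with `G = C + (lam/2) I + ∑ cᵢ xᵢ xᵢᵀ` and coefficients
`cᵢ` depending on `W`. A symmetric `G` killed by a `W` of rank `k` has rank at most `d - k`, and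
such matrices have codimension `k(k+1)/2`. The `n` free coefficients do not make up for this when `n
< k(k+1)/2`, so almost surely no critical point has rank `k` (`volume_setOf_annihilated_eq_zero`).

At a critical point there is then `u ≠ 0` with `uᵀ W = 0`, and the Hessian in direction `u vᵀ` is `2
|u|² vᵀ G v` (`hessian_gramLoss_vecMulVec`). If some `v` makes this negative, `W` is no local
minimum and any saddle there is strict. Otherwise `G` is positive semidefinite, and convexity of the
loss in the Gram matrix makes `W` a global minimum (`isGlobalMin_gramLoss`). -/

namespace QuadraticNet

/-! ### Dimension count: full-rank critical points exist only for a null set of `C`. -/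

/-- The range of a `C¹` map into `ι → ℝ` from a space of smaller dimension is a null set. -/
theorem volume_range_eq_zero_of_finrank_lt {E ι : Type*} [NormedAddCommGroup E] [NormedSpace ℝ E]
    [FiniteDimensional ℝ E] [Fintype ι] {f : E → ι → ℝ} (hf : ContDiff ℝ 1 f)
    (h : Module.finrank ℝ E < Fintype.card ι) : volume (Set.range f) = 0 := by
  have h1 : dimH (Set.range f) < ((Fintype.card ι : NNReal) : ENNReal) :=
    hf.dimH_range_le.trans_lt (by exact_mod_cast h)
  have h2 := hausdorffMeasure_of_dimH_lt h1
  rw [← hausdorffMeasure_pi_real]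
  exact_mod_cast h2

/-- Positions on and above the diagonal, outside the block `J × J`. -/
abbrev UpperOutside {d : ℕ} (J : Finset (Fin d)) : Type :=
  {p : {p : Fin d × Fin d // p.1 ≤ p.2} // ¬(p.1.1 ∈ J ∧ p.1.2 ∈ J)}

/-- Upper positions within `J × J` are the unordered pairs, repetition allowed, from `J`. -/
theorem card_upper_block {d : ℕ} (J : Finset (Fin d)) :
    Fintype.card {p : {p : Fin d × Fin d // p.1 ≤ p.2} // p.1.1 ∈ J ∧ p.1.2 ∈ J} =
      (J.card + 1).choose 2 := by
  rw [← Finset.card_sym2, ← Fintype.card_coe]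
  refine Fintype.card_congr (Sym2.sortEquiv.symm.subtypeEquiv ?_)
  rintro ⟨⟨a, b⟩, hab⟩
  simp [Sym2.sortEquiv]

theorem card_upperOutside_add {d : ℕ} (J : Finset (Fin d)) :
    Fintype.card (UpperOutside J) + (J.card + 1).choose 2 =
      Fintype.card {p : Fin d × Fin d // p.1 ≤ p.2} := by
  rw [← card_upper_block, add_comm, ← Fintype.card_sum]
  exact Fintype.card_congr (Equiv.sumCompl _)

/-- The symmetric matrix with prescribed entries outside the block `J × J`, and zero there. -/
def symmOutside {d : ℕ} (J : Finset (Fin d)) (z : UpperOutside J → ℝ) :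
    Matrix (Fin d) (Fin d) ℝ :=
  Matrix.of fun i j =>
    if h : ¬(min i j ∈ J ∧ max i j ∈ J) then z ⟨⟨(min i j, max i j), min_le_max⟩, h⟩ else 0

/-- The matrix which is the identity on the rows outside `J`, and on the rows in `J` has the
entries of `symmOutside J z` in the columns outside `J` and zeros elsewhere. -/
def rowExtension {d : ℕ} (J : Finset (Fin d)) (z : UpperOutside J → ℝ) :
    Matrix (Fin d) (Fin d) ℝ :=
  Matrix.of fun i j =>
    if j ∈ J then 0 else if i ∈ J then symmOutside J z i j else if i = j then 1 else 0

theorem exists_symmOutside_eq {d : ℕ} (J : Finset (Fin d)) (B : Fin d → Fin d → ℝ)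
    (hB : ∀ i j, B i j = B j i) :
    ∃ z, ∀ i j, ¬(i ∈ J ∧ j ∈ J) → symmOutside J z i j = B i j := by
  refine ⟨fun p => B p.1.1.1 p.1.1.2, fun i j hij => ?_⟩
  rcases le_total i j with h | h
  · simp [symmOutside, h]
    tauto
  · simp [symmOutside, h, hB i j]
    tauto

theorem contDiff_symmOutside {d : ℕ} (J : Finset (Fin d)) (i j : Fin d) :
    ContDiff ℝ 1 fun z => symmOutside J z i j := by
  simp only [symmOutside, Matrix.of_apply]
  split_ifs
  · fun_prop
  · fun_prop

theorem contDiff_rowExtension {d : ℕ} (J : Finset (Fin d)) (i j : Fin d) :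
    ContDiff ℝ 1 fun z => rowExtension J z i j := by
  simp only [rowExtension, Matrix.of_apply]
  split_ifs
  · fun_prop
  · exact contDiff_symmOutside J i j
  · fun_prop
  · fun_prop

/-- If the columns of `W` span, some `k` of the columns form a basis, and for each matrix `A` with
`W * A = 0` the corresponding rows of `A` are fixed combinations of the other rows. -/
theorem exists_rows_eq_sum {k d : ℕ} (W : Matrix (Fin k) (Fin d) ℝ)
    (hW : Submodule.span ℝ (Set.range Wᵀ) = ⊤) :
    ∃ J : Finset (Fin d), J.card = k ∧ ∃ m : Fin d → Fin d → ℝ,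
      ∀ A : Matrix (Fin d) (Fin d) ℝ, W * A = 0 →
        ∀ i ∈ J, ∀ l, A i l = ∑ j, if j ∈ J then 0 else m i j * A j l := by
  classical
  obtain ⟨κ, a, ha, hspan, hli⟩ := exists_linearIndependent' ℝ Wᵀ
  have : Finite κ := Finite.of_injective a ha
  have := Fintype.ofFinite κ
  let b : Module.Basis κ ℝ (Fin k → ℝ) := .mk hli (by rw [hspan, hW])
  have hb : ∀ q, b q = Wᵀ (a q) := fun q => by rw [Module.Basis.mk_apply]; rfl
  -- Up to sign, `m i j` is the coordinate of column `j` along basis column `i`. The default 0 of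
  -- `Function.extend` only concerns `i ∉ J`, where `m` is never read.
  refine ⟨Finset.univ.map ⟨a, ha⟩, ?_, fun i j =>
    -(Function.extend a (fun q => b.repr (Wᵀ j) q) 0 i), ?_⟩
  · rw [Finset.card_map, Finset.card_univ, ← Module.finrank_eq_card_basis b, Module.finrank_fin_fun]
  · intro A hA i hi l
    obtain ⟨q, rfl⟩ : ∃ q, a q = i := by simpa using hi
    have h0 : ∑ j, A j l • Wᵀ j = 0 := by
      ext r
      have := congrFun (congrFun hA r) l
      simp only [Matrix.mul_apply, Matrix.zero_apply] at this
      simpa [Finset.sum_apply, mul_comm] using this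
    have h1 : ∑ j, A j l * b.repr (Wᵀ j) q = 0 := by
      have := congrArg (fun v => b.repr v q) h0
      simpa [Finsupp.finsetSum_apply] using this
    -- A basis column has coordinates 0 or 1, so the relation splits into the term `j = a q` and a
    -- sum over non-basis columns.
    have h2 : ∀ j, A j l * b.repr (Wᵀ j) q =
        (if j = a q then A j l else 0) -
          if j ∈ Finset.univ.map ⟨a, ha⟩ then 0 else -(b.repr (Wᵀ j) q) * A j l := by
      intro j
      by_cases hj : ∃ p, a p = j
      · obtain ⟨p, rfl⟩ := hj
        rw [← hb, b.repr_self, Finsupp.single_apply]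
        simp [ha.eq_iff]
      · have : j ≠ a q := fun h => hj ⟨q, h.symm⟩
        simp [hj, this, mul_comm]
    rw [Finset.sum_congr rfl fun j _ => h2 j, Finset.sum_sub_distrib, Finset.sum_ite_eq',
      if_pos (Finset.mem_univ _)] at h1
    simp only [ha.extend_apply]
    linarith

/-- With `Q = rowExtension J z`, the row relations say `Q A = A`, and symmetry gives `A = Q A Qᵀ`.
Since `Q` vanishes on the columns in `J`, this reads only the entries of `A` outside the rows and
columns in `J`. -/
theorem exists_eq_rowExtension_mul {k d : ℕ} (W : Matrix (Fin k) (Fin d) ℝ)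
    (hW : Submodule.span ℝ (Set.range Wᵀ) = ⊤) (A : Matrix (Fin d) (Fin d) ℝ) (hA : Aᵀ = A)
    (hWA : W * A = 0) :
    ∃ J : Finset (Fin d), J.card = k ∧ ∃ z,
      A = rowExtension J z * symmOutside J z * (rowExtension J z)ᵀ := by
  obtain ⟨J, hJ, m, hm⟩ := exists_rows_eq_sum W hW
  have hAs : ∀ i j, A i j = A j i := fun i j => congrFun (congrFun hA j) i
  -- One `z` stores both kinds of data: the coefficients `m` where exactly one index lies in `J`,
  -- and the entries of `A` where none does.
  obtain ⟨z, hz⟩ := exists_symmOutside_eq J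
    (fun i j => if i ∈ J then if j ∈ J then 0 else m i j else if j ∈ J then m j i else A i j) (by
      intro i j
      by_cases hi : i ∈ J <;> by_cases hj : j ∈ J <;> simp [hi, hj, hAs i j])
  refine ⟨J, hJ, z, ?_⟩
  have hQA : rowExtension J z * A = A := by
    ext i l
    rw [Matrix.mul_apply]
    by_cases hi : i ∈ J
    · rw [hm A hWA i hi l]
      refine Finset.sum_congr rfl fun j _ => ?_
      by_cases hj : j ∈ J
      · simp [rowExtension, hj]
      · simp [rowExtension, hj, hi, hz i j]
    · rw [Finset.sum_eq_single i]
      · simp [rowExtension, hi]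
      · intro j _ hj
        simp [rowExtension, hi, hj.symm]
      · simp
  have hQZ : rowExtension J z * symmOutside J z * (rowExtension J z)ᵀ =
      rowExtension J z * A * (rowExtension J z)ᵀ := by
    ext i l
    simp only [Matrix.mul_apply, Matrix.transpose_apply, Finset.sum_mul]
    refine Finset.sum_congr rfl fun p _ => Finset.sum_congr rfl fun q _ => ?_
    by_cases hp : p ∈ J
    · simp [rowExtension, hp]
    by_cases hq : q ∈ J
    · simp [rowExtension, hq]
    rw [hz q p (by tauto)]
    simp [hp, hq]
  rw [hQZ, hQA]
  nth_rw 1 [← hA, ← hQA]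
  rw [Matrix.transpose_mul, hA]

/-- The upper entries of those symmetric `C` for which some matrix in `C + R + span P` is
annihilated by a `k × d` matrix of rank `k` form a null set. -/
theorem volume_setOf_annihilated_eq_zero {n k d : ℕ} (hn : n < (k + 1).choose 2)
    (R : Matrix (Fin d) (Fin d) ℝ) (hR : Rᵀ = R)
    (P : Fin n → Matrix (Fin d) (Fin d) ℝ) (hP : ∀ i, (P i)ᵀ = P i) :
    volume (upperEntries '' {C : Matrix (Fin d) (Fin d) ℝ | Cᵀ = C ∧
      ∃ (W : Matrix (Fin k) (Fin d) ℝ) (c : Fin n → ℝ),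
        Submodule.span ℝ (Set.range Wᵀ) = ⊤ ∧ W * (C + R + ∑ i, c i • P i) = 0}) = 0 := by
  -- Solving for `C`: the domain has dimension `n + d(d+1)/2 - k(k+1)/2` when `J` has `k` elements,
  -- and there are finitely many `J`.
  let f (J : Finset (Fin d)) (p : (Fin n → ℝ) × (UpperOutside J → ℝ)) :
      {p : Fin d × Fin d // p.1 ≤ p.2} → ℝ :=
    upperEntries (rowExtension J p.2 * symmOutside J p.2 * (rowExtension J p.2)ᵀ -
      (R + ∑ i, p.1 i • P i))
  have hf : ∀ J, ContDiff ℝ 1 (f J) := by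
    intro J
    refine contDiff_pi.2 fun q => ?_
    have h1 : ∀ i j, ContDiff ℝ 1 fun p : (Fin n → ℝ) × (UpperOutside J → ℝ) =>
        symmOutside J p.2 i j := fun i j => (contDiff_symmOutside J i j).comp contDiff_snd
    have h2 : ∀ i j, ContDiff ℝ 1 fun p : (Fin n → ℝ) × (UpperOutside J → ℝ) =>
        rowExtension J p.2 i j := fun i j => (contDiff_rowExtension J i j).comp contDiff_snd
    simp only [f, upperEntries, Matrix.sub_apply, Matrix.mul_apply, Matrix.transpose_apply,
      Matrix.add_apply, Matrix.sum_apply, Matrix.smul_apply, smul_eq_mul]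
    fun_prop
  have hnull : volume (⋃ J ∈ (Finset.univ.filter fun J : Finset (Fin d) => J.card = k),
      Set.range (f J)) = 0 := by
    refine (measure_biUnion_null_iff (Finset.countable_toSet _)).2 fun J hJ => ?_
    have hJk : J.card = k := by simpa using hJ
    refine volume_range_eq_zero_of_finrank_lt (hf J) ?_
    have := card_upperOutside_add J
    rw [hJk] at this
    rw [Module.finrank_prod, Module.finrank_fintype_fun_eq_card,
      Module.finrank_fintype_fun_eq_card, Fintype.card_fin]
    omega
  refine measure_mono_null ?_ hnull
  rintro _ ⟨C, ⟨hC, W, c, hW, hWG⟩, rfl⟩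
  have hsymm : (C + R + ∑ i, c i • P i)ᵀ = C + R + ∑ i, c i • P i := by
    simp [Matrix.transpose_sum, hC, hR, hP]
  obtain ⟨J, hJ, z, hz⟩ := exists_eq_rowExtension_mul W hW _ hsymm hWG
  simp only [Set.mem_iUnion]
  refine ⟨J, by simpa using hJ, (c, z), ?_⟩
  simp only [f, ← hz]
  congr 1
  abel

/-- Row rank equals column rank. -/
theorem exists_vecMul_eq_zero_or_span_eq_top {k d : ℕ} (W : Matrix (Fin k) (Fin d) ℝ) :
    (∃ u, u ≠ 0 ∧ u ᵥ* W = 0) ∨ Submodule.span ℝ (Set.range Wᵀ) = ⊤ := by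
  by_cases h : LinearIndependent ℝ W.row
  · right
    apply Submodule.eq_top_of_finrank_eq
    rw [Module.finrank_fin_fun]
    have := h.rank_matrix
    rw [Matrix.rank_eq_finrank_span_cols, Fintype.card_fin] at this
    exact this
  · left
    rw [← Matrix.vecMul_injective_iff] at h
    rw [← Matrix.coe_vecMulLinear, injective_iff_map_eq_zero] at h
    push Not at h
    obtain ⟨u, hu, hu0⟩ := h
    exact ⟨u, hu0, hu⟩

/-! ### Convexity and second-order conditions along lines. -/

section Calculus

/-- The tangent line at `a` supports a differentiable convex function. -/
theorem _root_.ConvexOn.add_deriv_mul_sub_le {φ : ℝ → ℝ} (hφ : ConvexOn ℝ Set.univ φ)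
    (hd : Differentiable ℝ φ) (a b : ℝ) : φ a + deriv φ a * (b - a) ≤ φ b := by
  rcases lt_trichotomy a b with h | rfl | h
  · have := hφ.deriv_le_slope (Set.mem_univ a) (Set.mem_univ b) h (hd a)
    rw [slope_def_field, le_div_iff₀ (by linarith)] at this
    linarith
  · simp
  · have := hφ.slope_le_deriv (Set.mem_univ b) (Set.mem_univ a) h (hd a)
    rw [slope_def_field, div_le_iff₀ (by linarith)] at this
    linarith

variable {E : Type*} [NormedAddCommGroup E] [NormedSpace ℝ E]

theorem hasDerivAt_comp_line {F : E → ℝ} (hF : Differentiable ℝ F) (W U : E) (t : ℝ) :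
    HasDerivAt (fun s : ℝ => F (W + s • U)) (fderiv ℝ F (W + t • U) U) t := by
  have h1 : HasDerivAt (fun s : ℝ => W + s • U) U t := by
    simpa using ((hasDerivAt_id t).smul_const U).const_add W
  exact (hF _).hasFDerivAt.comp_hasDerivAt t h1

theorem hasDerivAt_fderiv_comp_line {F : E → ℝ} (hF : ContDiff ℝ 2 F) (W U : E) :
    HasDerivAt (fun s : ℝ => fderiv ℝ F (W + s • U) U) (fderiv ℝ (fderiv ℝ F) W U U) 0 := by
  have h1 : HasDerivAt (fun s : ℝ => W + s • U) U 0 := by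
    simpa using ((hasDerivAt_id (0 : ℝ)).smul_const U).const_add W
  have h2 : Differentiable ℝ (fderiv ℝ F) :=
    (hF.fderiv_right (m := 1) (by norm_num)).differentiable one_ne_zero
  have h3 : HasFDerivAt (fderiv ℝ F) (fderiv ℝ (fderiv ℝ F) W) (W + (0 : ℝ) • U) := by
    simpa using (h2 W).hasFDerivAt
  have h4 := h3.comp_hasDerivAt 0 h1
  simpa using! h4.clm_apply (hasDerivAt_const (0 : ℝ) U)

/-- The second-order necessary condition for a local minimum. -/
theorem fderiv_fderiv_nonneg_of_isLocalMin {F : E → ℝ} (hF : ContDiff ℝ 2 F) {W : E}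
    (h : IsLocalMin F W) (U : E) : 0 ≤ fderiv ℝ (fderiv ℝ F) W U U := by
  by_contra! hneg
  set g : ℝ → ℝ := fun s => F (W + s • U)
  have hd : Differentiable ℝ F := hF.differentiable two_ne_zero
  have hg' : deriv g = fun s => fderiv ℝ F (W + s • U) U :=
    funext fun s => (hasDerivAt_comp_line hd W U s).deriv
  have hg'' : deriv (deriv g) 0 = fderiv ℝ (fderiv ℝ F) W U U := by
    rw [hg']
    exact (hasDerivAt_fderiv_comp_line hF W U).deriv
  have hc : Continuous g := by
    have := hF.continuous
    fun_prop
  have hmin : IsLocalMin g 0 := by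
    have h0 : Filter.Tendsto (fun s : ℝ => W + s • U) (nhds 0) (nhds W) := by
      have : Continuous fun s : ℝ => W + s • U := by fun_prop
      simpa using this.tendsto 0
    filter_upwards [h0.eventually h] with s hs
    simpa [g] using hs
  -- A negative second derivative would make 0 a local maximum too, so `g` would be locally constant
  -- with second derivative zero.
  have hmax : IsLocalMax g 0 :=
    isLocalMax_of_deriv_deriv_neg (hg''.trans_lt hneg) hmin.deriv_eq_zero hc.continuousAt
  have heq : g =ᶠ[nhds 0] fun _ => g 0 := by
    filter_upwards [hmin, hmax] with s h1 h2 using le_antisymm h2 h1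
  have := heq.deriv.deriv_eq
  rw [hg''] at this
  simp at this
  linarith

end Calculus

/-! ### Quadratic forms in the rows of a matrix. -/

/-- The pairing `tr(V G Uᵀ) = ∑ⱼ vⱼᵀ G uⱼ` of the rows of `V` and `U`. -/
def rowPairing {k d : ℕ} (G : Matrix (Fin d) (Fin d) ℝ) (V U : Matrix (Fin k) (Fin d) ℝ) : ℝ :=
  (V * G * Uᵀ).trace

section RowPairing

variable {k d : ℕ} (G H : Matrix (Fin d) (Fin d) ℝ) (V U : Matrix (Fin k) (Fin d) ℝ)

theorem rowPairing_add_left : rowPairing (G + H) V U = rowPairing G V U + rowPairing H V U := by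
  simp [rowPairing, Matrix.mul_add, Matrix.add_mul]

theorem rowPairing_smul_left (c : ℝ) : rowPairing (c • G) V U = c * rowPairing G V U := by
  simp [rowPairing]

theorem rowPairing_sum_left {ι : Type*} (s : Finset ι) (G : ι → Matrix (Fin d) (Fin d) ℝ) :
    rowPairing (∑ i ∈ s, G i) V U = ∑ i ∈ s, rowPairing (G i) V U := by
  simp [rowPairing, Matrix.mul_sum, Matrix.sum_mul, Matrix.trace_sum]

variable {G} in
theorem rowPairing_comm (hG : Gᵀ = G) : rowPairing G V U = rowPairing G U V := by
  rw [rowPairing, ← Matrix.trace_transpose]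
  simp [rowPairing, Matrix.transpose_mul, hG, Matrix.mul_assoc]

variable {G} in
theorem rowPairing_line (hG : Gᵀ = G) (t : ℝ) :
    rowPairing G (V + t • U) (V + t • U) =
      rowPairing G V V + 2 * t * rowPairing G V U + t ^ 2 * rowPairing G U U := by
  have h := rowPairing_comm V U hG
  simp only [rowPairing] at h ⊢
  simp only [Matrix.transpose_add, Matrix.transpose_smul, Matrix.add_mul, Matrix.mul_add, Matrix.trace_add,
    Matrix.smul_mul, Matrix.mul_smul, Matrix.trace_smul, smul_eq_mul]
  rw [← h]
  ring

theorem rowPairing_vecMulVec_of_vecMul_eq_zero {u : Fin k → ℝ} (hu : u ᵥ* V = 0)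
    (v : Fin d → ℝ) : rowPairing G V (Matrix.vecMulVec u v) = 0 := by
  rw [rowPairing, Matrix.transpose_vecMulVec, Matrix.mul_vecMulVec, Matrix.trace_vecMulVec,
    dotProduct_comm, Matrix.dotProduct_mulVec, ← Matrix.vecMul_vecMul, hu]
  simp

theorem rowPairing_vecMulVec_self (u : Fin k → ℝ) (v : Fin d → ℝ) :
    rowPairing G (Matrix.vecMulVec u v) (Matrix.vecMulVec u v) =
      (u ⬝ᵥ u) * (v ⬝ᵥ G *ᵥ v) := by
  rw [rowPairing, Matrix.transpose_vecMulVec, Matrix.vecMulVec_mul, Matrix.vecMulVec_mul_vecMulVec,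
    Matrix.trace_vecMulVec, Matrix.dotProduct_mulVec]
  simp [mul_comm]

theorem contDiff_rowPairing :
    ContDiff ℝ 2 fun W : Matrix (Fin k) (Fin d) ℝ => rowPairing G W W := by
  have h : ∀ i j, ContDiff ℝ 2 fun W : Matrix (Fin k) (Fin d) ℝ => W i j := fun i j =>
    (LinearMap.toContinuousLinearMap (Matrix.entryLinearMap ℝ ℝ i j)).contDiff
  simp only [rowPairing, Matrix.trace, Matrix.diag_apply, Matrix.mul_apply, Matrix.transpose_apply]
  exact ContDiff.sum fun i _ => ContDiff.sum fun j _ =>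
    (ContDiff.sum fun a _ => (h i a).mul contDiff_const).mul (h i j)

end RowPairing

/-! ### Critical points of convex functions of the Gram matrix. -/

section GramLoss

variable {n k d : ℕ} (φ : Fin n → ℝ → ℝ) (P : Fin n → Matrix (Fin d) (Fin d) ℝ)
  (R : Matrix (Fin d) (Fin d) ℝ)

/-- A sum of functions of quadratic forms in the rows of `W`, plus a quadratic form. -/
def gramLoss (W : Matrix (Fin k) (Fin d) ℝ) : ℝ :=
  ∑ i, φ i (rowPairing (P i) W W) + rowPairing R W W

/-- The matrix `G` such that the gradient of `gramLoss` at `W` is `2 W G`. -/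
noncomputable def gramGradient (W : Matrix (Fin k) (Fin d) ℝ) : Matrix (Fin d) (Fin d) ℝ :=
  R + ∑ i, deriv (φ i) (rowPairing (P i) W W) • P i

variable {φ P R}

theorem rowPairing_gramGradient (W V U : Matrix (Fin k) (Fin d) ℝ) :
    rowPairing (gramGradient φ P R W) V U = rowPairing R V U +
      ∑ i, deriv (φ i) (rowPairing (P i) W W) * rowPairing (P i) V U := by
  simp [gramGradient, rowPairing_add_left, rowPairing_sum_left, rowPairing_smul_left]

theorem transpose_gramGradient (hP : ∀ i, (P i)ᵀ = P i) (hR : Rᵀ = R)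
    (W : Matrix (Fin k) (Fin d) ℝ) : (gramGradient φ P R W)ᵀ = gramGradient φ P R W := by
  simp [gramGradient, Matrix.transpose_sum, hP, hR]

theorem contDiff_gramLoss (hφ : ∀ i, ContDiff ℝ 2 (φ i)) :
    ContDiff ℝ 2 (gramLoss φ P R : Matrix (Fin k) (Fin d) ℝ → ℝ) :=
  (ContDiff.sum fun i _ => (hφ i).comp (contDiff_rowPairing (P i))).add (contDiff_rowPairing R)

theorem hasDerivAt_gramLoss_line (hφ : ∀ i, ContDiff ℝ 2 (φ i)) (hP : ∀ i, (P i)ᵀ = P i)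
    (hR : Rᵀ = R) (W U : Matrix (Fin k) (Fin d) ℝ) (t : ℝ) :
    HasDerivAt (fun s : ℝ => gramLoss φ P R (W + s • U))
      (∑ i, deriv (φ i) (rowPairing (P i) (W + t • U) (W + t • U)) *
          (2 * rowPairing (P i) W U + 2 * t * rowPairing (P i) U U) +
        (2 * rowPairing R W U + 2 * t * rowPairing R U U)) t := by
  have key : ∀ Q : Matrix (Fin d) (Fin d) ℝ, Qᵀ = Q →
      HasDerivAt (fun s : ℝ => rowPairing Q (W + s • U) (W + s • U))
        (2 * rowPairing Q W U + 2 * t * rowPairing Q U U) t := by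
    intro Q hQ
    simp only [rowPairing_line _ _ hQ]
    have := (((hasDerivAt_id t).const_mul 2).mul_const (rowPairing Q W U)).const_add
      (rowPairing Q W W) |>.add (((hasDerivAt_id t).pow 2).mul_const (rowPairing Q U U))
    convert! this using 1
    simp
  refine (HasDerivAt.fun_sum fun i _ => ?_).add (key R hR)
  have h := (((hφ i).differentiable two_ne_zero)
    (rowPairing (P i) (W + t • U) (W + t • U))).hasDerivAt
  exact h.comp t (key (P i) (hP i))

theorem fderiv_gramLoss_line (hφ : ∀ i, ContDiff ℝ 2 (φ i)) (hP : ∀ i, (P i)ᵀ = P i)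
    (hR : Rᵀ = R) (W U : Matrix (Fin k) (Fin d) ℝ) (t : ℝ) :
    fderiv ℝ (gramLoss φ P R) (W + t • U) U =
      ∑ i, deriv (φ i) (rowPairing (P i) (W + t • U) (W + t • U)) *
          (2 * rowPairing (P i) W U + 2 * t * rowPairing (P i) U U) +
        (2 * rowPairing R W U + 2 * t * rowPairing R U U) :=
  (hasDerivAt_comp_line ((contDiff_gramLoss hφ).differentiable two_ne_zero) W U t).unique
    (hasDerivAt_gramLoss_line hφ hP hR W U t)

theorem fderiv_gramLoss (hφ : ∀ i, ContDiff ℝ 2 (φ i)) (hP : ∀ i, (P i)ᵀ = P i)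
    (hR : Rᵀ = R) (W U : Matrix (Fin k) (Fin d) ℝ) :
    fderiv ℝ (gramLoss φ P R) W U = 2 * rowPairing (gramGradient φ P R W) W U := by
  have h := fderiv_gramLoss_line hφ hP hR W U 0
  simp only [zero_smul, add_zero, mul_zero, zero_mul] at h
  rw [h, rowPairing_gramGradient, mul_add, Finset.mul_sum, add_comm]
  congr 1
  exact Finset.sum_congr rfl fun i _ => by ring

/-- Testing the derivative in the direction `W G` gives `2 ‖W G‖²`. -/
theorem mul_gramGradient_eq_zero (hφ : ∀ i, ContDiff ℝ 2 (φ i)) (hP : ∀ i, (P i)ᵀ = P i)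
    (hR : Rᵀ = R) {W : Matrix (Fin k) (Fin d) ℝ} (hW : fderiv ℝ (gramLoss φ P R) W = 0) :
    W * gramGradient φ P R W = 0 := by
  have h := fderiv_gramLoss hφ hP hR W (W * gramGradient φ P R W)
  rw [hW, zero_apply, rowPairing, ← Matrix.conjTranspose_eq_transpose_of_trivial]
    at h
  rw [← Matrix.trace_mul_conjTranspose_self_eq_zero_iff]
  linarith

/-- In a direction `u vᵀ` with `uᵀ W = 0`, the Hessian of `gramLoss` is `2 |u|² vᵀ G v`. -/
theorem hessian_gramLoss_vecMulVec (hφ : ∀ i, ContDiff ℝ 2 (φ i)) (hP : ∀ i, (P i)ᵀ = P i)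
    (hR : Rᵀ = R) (W : Matrix (Fin k) (Fin d) ℝ) {u : Fin k → ℝ} (hu : u ᵥ* W = 0)
    (v : Fin d → ℝ) :
    fderiv ℝ (fderiv ℝ (gramLoss φ P R)) W (Matrix.vecMulVec u v) (Matrix.vecMulVec u v) =
      2 * ((u ⬝ᵥ u) * (v ⬝ᵥ gramGradient φ P R W *ᵥ v)) := by
  set U := Matrix.vecMulVec u v
  -- Because `uᵀ W = 0`, the cross terms vanish and the directional derivative is `t * h t`. Its
  -- derivative at 0 is `h 0` by continuity of `h` alone, so `φ''` never enters.
  have hline : (fun t : ℝ => fderiv ℝ (gramLoss φ P R) (W + t • U) U) = fun t => t *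
      (∑ i, deriv (φ i) (rowPairing (P i) (W + t • U) (W + t • U)) *
          (2 * rowPairing (P i) U U) + 2 * rowPairing R U U) := by
    funext t
    rw [fderiv_gramLoss_line hφ hP hR]
    simp only [U, rowPairing_vecMulVec_of_vecMul_eq_zero _ _ hu, mul_zero, zero_add]
    rw [mul_add, Finset.mul_sum]
    congr 1
    · exact Finset.sum_congr rfl fun i _ => by ring
    · ring
  have h1 : HasDerivAt (fun t : ℝ => fderiv ℝ (gramLoss φ P R) (W + t • U) U)
      (fderiv ℝ (fderiv ℝ (gramLoss φ P R)) W U U) 0 :=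
    hasDerivAt_fderiv_comp_line (contDiff_gramLoss hφ) W U
  rw [hline] at h1
  set h : ℝ → ℝ := fun t => ∑ i, deriv (φ i) (rowPairing (P i) (W + t • U) (W + t • U)) *
    (2 * rowPairing (P i) U U) + 2 * rowPairing R U U
  have hc : Continuous h := by
    have h2 : ∀ i, Continuous (deriv (φ i)) := fun i => (hφ i).continuous_deriv (by norm_num)
    have h3 : ∀ i, Continuous fun t : ℝ => rowPairing (P i) (W + t • U) (W + t • U) := fun i => by
      simp only [rowPairing_line _ _ (hP i)]
      fun_prop
    fun_prop
  have h2 : HasDerivAt (fun t => t * h t) (h 0) 0 := by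
    rw [hasDerivAt_iff_tendsto_slope]
    refine ((hc.tendsto 0).mono_left nhdsWithin_le_nhds).congr' ?_
    filter_upwards [self_mem_nhdsWithin] with t ht
    have : t ≠ 0 := ht
    simp [slope_def_field, this]
  rw [h1.unique h2, ← rowPairing_vecMulVec_self, rowPairing_gramGradient, mul_add,
    Finset.mul_sum, add_comm]
  simp only [h, zero_smul, add_zero]
  congr 1
  exact Finset.sum_congr rfl fun i _ => by ring

/-- Summing the tangent-line inequalities bounds the increase from `W` to `V` below by `tr(V G Vᵀ) -
tr(W G Wᵀ)`; the second trace is 0 and the first is nonnegative. -/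
theorem isGlobalMin_gramLoss (hconv : ∀ i, ConvexOn ℝ Set.univ (φ i))
    (hφ : ∀ i, ContDiff ℝ 2 (φ i)) {W : Matrix (Fin k) (Fin d) ℝ}
    (hW : W * gramGradient φ P R W = 0) (hG : (gramGradient φ P R W).PosSemidef) :
    IsGlobalMin (gramLoss φ P R) W := by
  intro V
  have h0 : rowPairing (gramGradient φ P R W) W W = 0 := by simp [rowPairing, hW]
  have h1 : 0 ≤ rowPairing (gramGradient φ P R W) V V := by
    rw [rowPairing, ← Matrix.conjTranspose_eq_transpose_of_trivial]
    exact (hG.mul_mul_conjTranspose_same V).trace_nonneg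
  rw [rowPairing_gramGradient] at h0 h1
  have h2 := Finset.sum_le_sum fun i (_ : i ∈ Finset.univ) =>
    (hconv i).add_deriv_mul_sub_le ((hφ i).differentiable two_ne_zero)
      (rowPairing (P i) W W) (rowPairing (P i) V V)
  simp only [mul_sub, Finset.sum_add_distrib, Finset.sum_sub_distrib] at h2
  simp only [gramLoss]
  linarith

theorem isGlobalMin_or_hessian_neg (hconv : ∀ i, ConvexOn ℝ Set.univ (φ i))
    (hφ : ∀ i, ContDiff ℝ 2 (φ i)) (hP : ∀ i, (P i)ᵀ = P i) (hR : Rᵀ = R)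
    {W : Matrix (Fin k) (Fin d) ℝ} (hW : fderiv ℝ (gramLoss φ P R) W = 0)
    {u : Fin k → ℝ} (hu0 : u ≠ 0) (hu : u ᵥ* W = 0) :
    IsGlobalMin (gramLoss φ P R) W ∨
      ∃ U, fderiv ℝ (fderiv ℝ (gramLoss φ P R)) W U U < 0 := by
  by_cases hG : ∀ v, 0 ≤ v ⬝ᵥ gramGradient φ P R W *ᵥ v
  · exact .inl (isGlobalMin_gramLoss hconv hφ (mul_gramGradient_eq_zero hφ hP hR hW)
      (.of_dotProduct_mulVec_nonneg (transpose_gramGradient hP hR W) hG))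
  · push Not at hG
    obtain ⟨v, hv⟩ := hG
    refine .inr ⟨Matrix.vecMulVec u v, ?_⟩
    rw [hessian_gramLoss_vecMulVec hφ hP hR W hu]
    have : 0 < u ⬝ᵥ u := by
      simpa using Matrix.dotProduct_star_self_pos_iff.2 hu0
    nlinarith

/-- If no critical point has full row rank, then local minima are global and saddles are strict. -/
theorem localMinimaGlobal_and_saddlesStrict (hconv : ∀ i, ConvexOn ℝ Set.univ (φ i))
    (hφ : ∀ i, ContDiff ℝ 2 (φ i)) (hP : ∀ i, (P i)ᵀ = P i) (hR : Rᵀ = R)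
    (hrank : ∀ (W : Matrix (Fin k) (Fin d) ℝ) (c : Fin n → ℝ), W * (R + ∑ i, c i • P i) = 0 →
      ∃ u, u ≠ 0 ∧ u ᵥ* W = 0) :
    LocalMinimaGlobal (gramLoss φ P R : Matrix (Fin k) (Fin d) ℝ → ℝ) ∧
      SaddlesStrict (gramLoss φ P R : Matrix (Fin k) (Fin d) ℝ → ℝ) := by
  have key : ∀ W : Matrix (Fin k) (Fin d) ℝ, fderiv ℝ (gramLoss φ P R) W = 0 →
      IsGlobalMin (gramLoss φ P R) W ∨
        ∃ U, fderiv ℝ (fderiv ℝ (gramLoss φ P R)) W U U < 0 := by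
    intro W hW
    -- The coefficients are the slopes of `φ i` at `W`; `hrank` allows arbitrary `c`, so their
    -- nonlinear dependence on `W` plays no role.
    obtain ⟨u, hu0, hu⟩ := hrank W _ (mul_gramGradient_eq_zero hφ hP hR hW)
    exact isGlobalMin_or_hessian_neg hconv hφ hP hR hW hu0 hu
  constructor
  · intro W hW
    refine (key W hW.fderiv_eq_zero).resolve_right ?_
    rintro ⟨U, hU⟩
    exact hU.not_ge (fderiv_fderiv_nonneg_of_isLocalMin (contDiff_gramLoss hφ) hW U)
  · rintro W ⟨hW, hlt⟩
    refine (key W hW).resolve_left fun hmin => ?_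
    obtain ⟨V, -, hV⟩ := hlt Set.univ Filter.univ_mem
    exact hV.not_ge (hmin V)

end GramLoss

/-! ### The training loss as a `gramLoss`, and the bound for the perturbed minimizer. -/

theorem frobenius_norm_sq_eq_trace {k d : ℕ} (W : Matrix (Fin k) (Fin d) ℝ) :
    ‖W‖ ^ 2 = (W * Wᵀ).trace := by
  rw [Matrix.frobenius_norm_def, ← Real.sqrt_eq_rpow, Real.sq_sqrt (by positivity)]
  simp [Matrix.trace, Matrix.mul_apply, sq]

theorem frobInner_le_norm_mul_norm {d : ℕ} (A B : Matrix (Fin d) (Fin d) ℝ) :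
    frobInner A B ≤ ‖A‖ * ‖B‖ := by
  have h := Real.sum_mul_le_sqrt_mul_sqrt Finset.univ
    (fun p : Fin d × Fin d => A p.2 p.1) (fun p => B p.2 p.1)
  rw [Fintype.sum_prod_type, Fintype.sum_prod_type, Fintype.sum_prod_type] at h
  have hnorm : ∀ M : Matrix (Fin d) (Fin d) ℝ, ‖M‖ = √(∑ i, ∑ j, M j i ^ 2) := by
    intro M
    rw [Matrix.frobenius_norm_def, ← Real.sqrt_eq_rpow, Finset.sum_comm]
    simp
  rw [hnorm A, hnorm B]
  simpa [frobInner, Matrix.trace, Matrix.mul_apply] using h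

theorem net_eq_rowPairing {k d : ℕ} (W : Matrix (Fin k) (Fin d) ℝ) (x : Fin d → ℝ) :
    net W x = rowPairing (Matrix.vecMulVec x x) W W := by
  rw [rowPairing, Matrix.mul_vecMulVec, Matrix.vecMulVec_mul, Matrix.trace_vecMulVec,
    Matrix.vecMul_transpose]
  simp only [net, act, sq]
  rfl

theorem frobInner_gram {k d : ℕ} {C : Matrix (Fin d) (Fin d) ℝ} (hC : Cᵀ = C)
    (W : Matrix (Fin k) (Fin d) ℝ) : frobInner C (Wᵀ * W) = rowPairing C W W := by
  rw [frobInner, hC, rowPairing, ← Matrix.mul_assoc, Matrix.trace_mul_cycle]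

/-- The regularizer and the perturbation are both quadratic forms, absorbed in `R`, where the sign
of `lam` is irrelevant. -/
theorem perturbedLoss_eq_gramLoss {n k d : ℕ} (ℓ : ℝ → ℝ → ℝ) (lam : ℝ) (x : Fin n → Fin d → ℝ)
    (y : Fin n → ℝ) {C : Matrix (Fin d) (Fin d) ℝ} (hC : Cᵀ = C) :
    (fun W : Matrix (Fin k) (Fin d) ℝ => perturbedLoss ℓ lam x y C W) =
      gramLoss (fun i a => 1 / (2 * (n : ℝ)) * ℓ a (y i))
        (fun i => Matrix.vecMulVec (x i) (x i)) (C + (lam / 2) • 1) := by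
  funext W
  rw [perturbedLoss, trainingLoss, gramLoss, frobInner_gram hC, rowPairing_add_left,
    rowPairing_smul_left, frobenius_norm_sq_eq_trace, Finset.mul_sum]
  simp only [net_eq_rowPairing]
  rw [show rowPairing 1 W W = (W * Wᵀ).trace by simp [rowPairing]]
  ring

/-- The perturbed minimizer is nearly optimal for the unperturbed loss. -/
theorem trainingLoss_le_add {n k d : ℕ} {ℓ : ℝ → ℝ → ℝ} {lam δ : ℝ} {x : Fin n → Fin d → ℝ}
    {y : Fin n → ℝ} {C : Matrix (Fin d) (Fin d) ℝ} (hC : C.PosSemidef) (hδ : ‖C‖ ≤ δ)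
    {What : Matrix (Fin k) (Fin d) ℝ} (h : IsGlobalMin (perturbedLoss ℓ lam x y C) What)
    (Wstar : Matrix (Fin k) (Fin d) ℝ) :
    trainingLoss ℓ lam x y What ≤ trainingLoss ℓ lam x y Wstar + δ * ‖Wstar‖ ^ 2 := by
  have hsymm : Cᵀ = C := hC.1
  have h1 : 0 ≤ frobInner C (Whatᵀ * What) := by
    rw [frobInner_gram hsymm, rowPairing, ← Matrix.conjTranspose_eq_transpose_of_trivial]
    exact (hC.mul_mul_conjTranspose_same What).trace_nonneg
  have h2 : frobInner C (Wstarᵀ * Wstar) ≤ δ * ‖Wstar‖ ^ 2 := by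
    calc frobInner C (Wstarᵀ * Wstar) ≤ ‖C‖ * ‖Wstarᵀ * Wstar‖ := frobInner_le_norm_mul_norm _ _
      _ ≤ δ * (‖Wstarᵀ‖ * ‖Wstar‖) := mul_le_mul hδ (Matrix.frobenius_norm_mul _ _)
          (norm_nonneg _) ((norm_nonneg _).trans hδ)
      _ = δ * ‖Wstar‖ ^ 2 := by rw [Matrix.frobenius_norm_transpose, sq]
  have h3 := h Wstar
  simp only [perturbedLoss] at h3
  linarith

end QuadraticNet

theorem theorem2 {n k d : ℕ} (x : Fin n → Fin d → ℝ) (y : Fin n → ℝ)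
    (ℓ : ℝ → ℝ → ℝ) (hconv : ∀ b, ConvexOn ℝ Set.univ fun a => ℓ a b)
    (hC2 : ∀ b, ContDiff ℝ 2 fun a => ℓ a b)
    (lam δ : ℝ)
    (hn : (n : ℝ) < (k : ℝ) * ((k : ℝ) + 1) / 2) (hkd : k < d)
    {Ω : Type*} [MeasurableSpace Ω] (μ : Measure Ω) [IsProbabilityMeasure μ]
    (C : Ω → Matrix (Fin d) (Fin d) ℝ)
    (hpsd : ∀ ω, (C ω).PosSemidef) (hδ : ∀ ω, ‖C ω‖ ≤ δ)
    (hlaw : QuadraticNet.HasAbsContLaw μ C) :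
    (∀ᵐ ω ∂μ,
      QuadraticNet.LocalMinimaGlobal
        (fun W : Matrix (Fin k) (Fin d) ℝ => QuadraticNet.perturbedLoss ℓ lam x y (C ω) W) ∧
      QuadraticNet.SaddlesStrict
        (fun W : Matrix (Fin k) (Fin d) ℝ => QuadraticNet.perturbedLoss ℓ lam x y (C ω) W)) ∧
    ∀ ω, ∀ What Wstar : Matrix (Fin k) (Fin d) ℝ,
      QuadraticNet.IsGlobalMin (QuadraticNet.perturbedLoss ℓ lam x y (C ω)) What →
      QuadraticNet.IsGlobalMin (QuadraticNet.trainingLoss ℓ lam x y) Wstar →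
      QuadraticNet.trainingLoss ℓ lam x y What ≤
        QuadraticNet.trainingLoss ℓ lam x y Wstar + δ * ‖Wstar‖ ^ 2 := by
  open QuadraticNet in
  refine ⟨?_, fun ω What Wstar h _ => trainingLoss_le_add (hpsd ω) (hδ ω) h Wstar⟩
  have hchoose : n < (k + 1).choose 2 := by
    have : ((k + 1).choose 2 : ℝ) = k * (k + 1) / 2 := by
      rw [Nat.cast_choose_two]
      push_cast
      ring
    exact_mod_cast hn.trans_eq this.symm
  have hR : ((lam / 2) • (1 : Matrix (Fin d) (Fin d) ℝ))ᵀ = (lam / 2) • 1 := by simp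
  have hP : ∀ i, (Matrix.vecMulVec (x i) (x i))ᵀ = Matrix.vecMulVec (x i) (x i) := fun i =>
    Matrix.transpose_vecMulVec _ _
  have hnull := hlaw.2 (volume_setOf_annihilated_eq_zero hchoose ((lam / 2) • 1) hR
    (fun i => Matrix.vecMulVec (x i) (x i)) hP)
  have hmeas : Measurable fun ω => upperEntries (C ω) :=
    measurable_pi_lambda _ fun p => hlaw.1 p.1.1 p.1.2
  filter_upwards [ae_of_ae_map hmeas.aemeasurable (measure_eq_zero_iff_ae_notMem.1 hnull)] with ω hω
  have hsymm : (C ω)ᵀ = C ω := (hpsd ω).1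
  rw [perturbedLoss_eq_gramLoss ℓ lam x y hsymm]
  refine localMinimaGlobal_and_saddlesStrict (fun i => ?_) (fun i => contDiff_const.mul (hC2 (y i)))
    hP (by rw [Matrix.transpose_add, hsymm, hR]) fun W c hWc => ?_
  -- Only `0 ≤ 1 / (2n)` is needed.
  · exact (hconv (y i)).smul (by positivity)
  · refine (exists_vecMul_eq_zero_or_span_eq_top W).resolve_right fun hspan => hω ?_
    exact ⟨C ω, ⟨hsymm, W, c, hspan, hWc⟩, rfl⟩
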